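/- Conventions. All graphs are finite: either a hypergraph $(V,E,\phi)$ with $\phi:E\to 2^V\setminus\{\emptyset\}$ (undirected graphs, with loops and multiple edges allowed, are the case $|\phi(e)|\le 2$), or a directed graph $(V,E,\psi)$ with $\psi:E\to V\times V$. A big edge is an edge incident with all vertices. A graph $H$ is a reconstruction of $G$, written $H\sim G$, if there is a bijection $f:V(G)\to V(H)$ with $G-v\cong H-f(v)$ for all $v\in V(G)$. Let $s(H,G)$ be the number of subgraphs of $G$ isomorphic to $H$. For a sequence $\mathcal F=(F_1,\dots,F_m)$ of graphs let $c(\mathcal F,G)$ be the number of sequences $(G_1,\dots,G_m)$ of subgraphs of $G$ with $G_i\cong F_i$ for all $i$ and $\bigcup_i G_i=G$. A class $\mathcal C_n$ (closed under isomorphism) of $n$-vertex graphs without big edges is finite if it has finitely many isomorphism classes; it is recognisable if every reconstruction without big edges of a graph in $\mathcal C_n$ is in $\mathcal C_n$; and it satisfies Kocay's lemma if, for every $G\in\mathcal C_n$, every sequence $\mathcal F$ of graphs with fewer than $n$ vertices and every reconstruction $G'$ of $G$ without big edges, $$\sum_{H\in\mathcal C_n/\cong}c(\mathcal F,H)\,s(H,G')=\sum_{H\in\mathcal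 C_n/\cong}c(\mathcal F,H)\,s(H,G).$$ For a family $\mathfrak F$ of sequences of graphs with at most $n-1$ vertices, let $M_{\mathfrak F,\mathcal C_n}$ be the real matrix with rows indexed by the $\mathcal F\in\mathfrak F$, columns indexed by $H\in\mathcal C_n/\cong$, and entries $c(\mathcal F,H)$. Two sequences are equivalent if there is a bijection between their terms that matches isomorphic graphs. Theorem. Let $n\ge 2$ and let $\mathcal C_n$ be a finite, recognisable class of $n$-vertex graphs without big edges that satisfies Kocay's lemma. Then there is a finite family $\mathfrak F$ of pairwise inequivalent sequences, each of length at most $n$, of $(n-1)$-vertex graphs such that $$\operatorname{rank}_{\mathbb R}(M_{\mathfrak F,\mathcal C_n})=|\mathcal C_n/\sim|.$$ Moreover, the same equality holds when $\mathfrak F$ is the (possibly infinite) family of all inequivalent sequences, of length at most $n$, of $(n-1)$-vertex graphs, that is, any family containing exactly one sequence from each equivalence class of such sequences. -/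

import Mathlib

namespace GraphDecks

/-- What an edge is attached to: a set of vertices (hyperedge) or an ordered pair (arc). -/
inductive EdgeEnds (V : Type) : Type
  | hyper (s : Set V) : EdgeEnds V
  | arc (tail head : V) : EdgeEnds V

namespace EdgeEnds

/-- The set of vertices incident with the edge. -/
def support {V : Type} : EdgeEnds V → Set V
  | hyper s => s
  | arc t h => {t, h}

def IsHyper {V : Type} : EdgeEnds V → Prop
  | hyper _ => True
  | arc _ _ => False

def IsArc {V : Type} : EdgeEnds V → Prop
  | hyper _ => False
  | arc _ _ => True

/-- Transport along a map of vertices. -/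
def map {V W : Type} (f : V → W) : EdgeEnds V → EdgeEnds W
  | hyper s => hyper (f '' s)
  | arc t h => arc (f t) (f h)

/-- An edge all of whose incident vertices lie in `S`, seen as an edge on `S`. -/
def restrict {V : Type} (S : Set V) : (d : EdgeEnds V) → d.support ⊆ S → EdgeEnds S
  | hyper s, _ => hyper (Subtype.val ⁻¹' s)
  | arc t h, hS => arc ⟨t, hS (Set.mem_insert t {h})⟩ ⟨h, hS (Set.mem_insert_of_mem t rfl)⟩

theorem map_id {V : Type} (d : EdgeEnds V) : d.map id = d := by
  cases d <;> simp [map]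

theorem map_map {U V W : Type} (f : U → V) (g : V → W) (d : EdgeEnds U) :
    (d.map f).map g = d.map (g ∘ f) := by
  cases d <;> simp [map, Set.image_image]

theorem restrict_support_nonempty {V : Type} (S : Set V) (d : EdgeEnds V) (h : d.support ⊆ S)
    (hd : d.support.Nonempty) : (d.restrict S h).support.Nonempty := by
  cases d with
  | hyper s => obtain ⟨x, hx⟩ := hd; exact ⟨⟨x, h hx⟩, hx⟩
  | arc t u => exact ⟨_, Set.mem_insert _ _⟩

theorem restrict_isHyper {V : Type} (S : Set V) (d : EdgeEnds V) (h : d.support ⊆ S)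
    (hd : d.IsHyper) : (d.restrict S h).IsHyper := by
  cases d with
  | hyper s => trivial
  | arc t u => exact hd

theorem restrict_isArc {V : Type} (S : Set V) (d : EdgeEnds V) (h : d.support ⊆ S)
    (hd : d.IsArc) : (d.restrict S h).IsArc := by
  cases d with
  | hyper s => exact hd
  | arc t u => trivial

end EdgeEnds

/-- A finite graph: either a hypergraph (every edge is a nonempty set of vertices) or a directed
graph (every edge is an ordered pair of vertices). Multiple edges and loops are allowed. -/
structure FinGraph : Type 1 where
  V : Type
  E : Type
  finV : Finite V
  finE : Finite E
  ends : E → EdgeEnds V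
  ends_nonempty : ∀ e, (ends e).support.Nonempty
  uniform : (∀ e, (ends e).IsHyper) ∨ (∀ e, (ends e).IsArc)

namespace FinGraph

/-- The number `v(G)` of vertices. -/
noncomputable def order (G : FinGraph) : ℕ := Nat.card G.V

/-- Graph isomorphism. -/
def Iso (G H : FinGraph) : Prop :=
  ∃ (f : G.V ≃ H.V) (g : G.E ≃ H.E), ∀ e, H.ends (g e) = (G.ends e).map f

theorem Iso.refl (G : FinGraph) : G.Iso G :=
  ⟨Equiv.refl _, Equiv.refl _, fun e => ((G.ends e).map_id).symm⟩

theorem Iso.symm {G H : FinGraph} : G.Iso H → H.Iso G := by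
  rintro ⟨f, g, h⟩
  refine ⟨f.symm, g.symm, fun e => ?_⟩
  have h1 := h (g.symm e)
  rw [Equiv.apply_symm_apply] at h1
  rw [h1, EdgeEnds.map_map, Equiv.symm_comp_self, EdgeEnds.map_id]

theorem Iso.trans {G H K : FinGraph} : G.Iso H → H.Iso K → G.Iso K := by
  rintro ⟨f, g, h⟩ ⟨f', g', h'⟩
  refine ⟨f.trans f', g.trans g', fun e => ?_⟩
  rw [Equiv.trans_apply, h', h, EdgeEnds.map_map, Equiv.coe_trans]

/-- A subgraph: a set of vertices and a set of edges all of whose ends are among them. -/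
@[ext]
structure Sub (G : FinGraph) where
  verts : Set G.V
  edges : Set G.E
  closed : ∀ e ∈ edges, (G.ends e).support ⊆ verts

/-- A subgraph as a graph in its own right. -/
def Sub.toGraph {G : FinGraph} (S : G.Sub) : FinGraph where
  V := S.verts
  E := S.edges
  finV := haveI := G.finV; inferInstance
  finE := haveI := G.finE; inferInstance
  ends e := (G.ends e.1).restrict S.verts (S.closed e.1 e.2)
  ends_nonempty e := EdgeEnds.restrict_support_nonempty _ _ _ (G.ends_nonempty e.1)
  uniform := G.uniform.imp
    (fun h e => EdgeEnds.restrict_isHyper _ _ _ (h e.1))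
    (fun h e => EdgeEnds.restrict_isArc _ _ _ (h e.1))

/-- The vertex-deleted subgraph `G - v`: delete `v` and all edges incident with `v`. -/
def del (G : FinGraph) (v : G.V) : FinGraph :=
  Sub.toGraph (G := G)
    { verts := {v}ᶜ
      edges := {e | v ∉ (G.ends e).support}
      closed := fun _ he _ hx hxv => he (Set.mem_singleton_iff.mp hxv ▸ hx) }

/-- `G.Recon H`: the graph `H` is a reconstruction of `G`. -/
def Recon (G H : FinGraph) : Prop :=
  ∃ f : G.V ≃ H.V, ∀ v, (G.del v).Iso (H.del (f v))

theorem Recon.refl (G : FinGraph) : G.Recon G :=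
  ⟨Equiv.refl _, fun v => Iso.refl (G.del v)⟩

theorem Recon.symm {G H : FinGraph} : G.Recon H → H.Recon G := by
  rintro ⟨f, h⟩
  refine ⟨f.symm, fun v => ?_⟩
  have h1 := (h (f.symm v)).symm
  rwa [Equiv.apply_symm_apply] at h1

theorem Recon.trans {G H K : FinGraph} : G.Recon H → H.Recon K → G.Recon K := by
  rintro ⟨f, h⟩ ⟨f', h'⟩
  exact ⟨f.trans f', fun v => (h v).trans (h' (f v))⟩

/-- No edge is incident with all vertices. -/
def NoBigEdge (G : FinGraph) : Prop := ∀ e, (G.ends e).support ≠ Set.univ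

end FinGraph

open FinGraph

/-- `s(H, G)`: the number of subgraphs of `G` isomorphic to `H`. -/
noncomputable def subCount (H G : FinGraph) : ℕ :=
  Nat.card {S : G.Sub // S.toGraph.Iso H}

/-- A cover of `G` by the sequence `F`: a sequence of subgraphs of `G`, the `i`-th one isomorphic
to the `i`-th graph of `F`, whose union is `G`. -/
def IsCover (F : List FinGraph) (G : FinGraph) (S : Fin F.length → G.Sub) : Prop :=
  (∀ i, (S i).toGraph.Iso (F.get i)) ∧
    (⋃ i, (S i).verts) = Set.univ ∧ (⋃ i, (S i).edges) = Set.univ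

/-- `c(F, G)`: the number of covers of `G` by the sequence `F`. -/
noncomputable def coverCount (F : List FinGraph) (G : FinGraph) : ℕ :=
  Nat.card {S : Fin F.length → G.Sub // IsCover F G S}

/-- `C` is a class of `n`-vertex graphs without big edges (closed under isomorphism). -/
def IsGraphClass (n : ℕ) (C : Set FinGraph) : Prop :=
  (∀ G ∈ C, G.order = n ∧ G.NoBigEdge) ∧ ∀ G ∈ C, ∀ H, G.Iso H → H ∈ C

/-- Every reconstruction without big edges of a graph in `C` is in `C`. -/
def Recognisable (C : Set FinGraph) : Prop :=
  ∀ G ∈ C, ∀ H : FinGraph, H.NoBigEdge → G.Recon H → H ∈ C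

def isoSetoid (C : Set FinGraph) : Setoid C where
  r G H := G.1.Iso H.1
  iseqv := ⟨fun G => Iso.refl G.1, Iso.symm, Iso.trans⟩

def reconSetoid (C : Set FinGraph) : Setoid C where
  r G H := G.1.Recon H.1
  iseqv := ⟨fun G => Recon.refl G.1, Recon.symm, Recon.trans⟩

/-- The isomorphism classes of the graphs in `C`. -/
abbrev IsoClass (C : Set FinGraph) : Type 1 := Quotient (isoSetoid C)

/-- The reconstruction classes of the graphs in `C`. -/
abbrev ReconClass (C : Set FinGraph) : Type 1 := Quotient (reconSetoid C)

/-- A representative graph of an isomorphism class. -/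
noncomputable def IsoClass.rep {C : Set FinGraph} (q : IsoClass C) : FinGraph := (Quotient.out q).1

/-- The sum of `c(F, H) s(H, G)` over all isomorphism classes `H` in `C`. (It has only finitely
many nonzero terms.) -/
noncomputable def kocaySum (C : Set FinGraph) (F : List FinGraph) (G : FinGraph) : ℕ :=
  ∑ᶠ q : IsoClass C, coverCount F q.rep * subCount q.rep G

/-- The class `C` of `n`-vertex graphs satisfies Kocay's lemma. -/
def SatisfiesKocay (n : ℕ) (C : Set FinGraph) : Prop :=
  ∀ G ∈ C, ∀ F : List FinGraph, (∀ X ∈ F, X.order < n) →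
    ∀ G' : FinGraph, G'.NoBigEdge → G.Recon G' → kocaySum C F G' = kocaySum C F G

/-- The matrix of covering numbers: rows indexed by the sequences of the family `𝔉`, columns by
the isomorphism classes of graphs in `C`. -/
noncomputable def coverMatrix {ι : Type*} (𝔉 : ι → List FinGraph) (C : Set FinGraph) :
    Matrix ι (IsoClass C) ℝ :=
  Matrix.of fun i q => (coverCount (𝔉 i) q.rep : ℝ)

/-- Two sequences are equivalent if some bijection of their terms matches isomorphic graphs. -/
def SeqEquiv (F F' : List FinGraph) : Prop :=
  ∃ σ : Fin F.length ≃ Fin F'.length, ∀ i, (F.get i).Iso (F'.get (σ i))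

/-- A sequence of length at most `n` of graphs with exactly `n - 1` vertices. -/
def IsCardSeq (n : ℕ) (F : List FinGraph) : Prop :=
  F.length ≤ n ∧ ∀ X ∈ F, X.order + 1 = n

/-- A family of pairwise inequivalent sequences of length at most `n` of `(n-1)`-vertex graphs. -/
def IsInequivCardFamily {ι : Type*} (n : ℕ) (𝔉 : ι → List FinGraph) : Prop :=
  (∀ i, IsCardSeq n (𝔉 i)) ∧ ∀ i j, i ≠ j → ¬ SeqEquiv (𝔉 i) (𝔉 j)

/-- The family of all inequivalent sequences of length at most `n` of `(n-1)`-vertex graphs: it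
contains exactly one member of each equivalence class of such sequences. -/
def IsFullCardFamily {ι : Type*} (n : ℕ) (𝔉 : ι → List FinGraph) : Prop :=
  IsInequivCardFamily n 𝔉 ∧ ∀ F, IsCardSeq n F → ∃ i, SeqEquiv (𝔉 i) F

end GraphDecks

namespace GraphDecks

/-! Two inequalities are proved for the matrix M of covering numbers.

Upper bound: let S be the matrix of numbers s(H, G) over the isomorphism classes. It is
unitriangular when graphs are ordered by number of edges, hence invertible. The entries of M S are
the Kocay sums, which are constant on reconstruction classes, so M S, and with it M, has rank at
most the number of those classes (`rank_coverMatrix_le`).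

Lower bound: the columns of representatives G_j of the reconstruction classes are independent
(`eq_zero_of_sum_coverCount_eq_zero`). Möbius inversion over the subgraphs K of G_j writes c(F, G_j)
as a combination of products of subgraph numbers of K (`exists_coverCount_eq_sum`). A linear
relation among the columns thus gives a functional on functions of pairs (j, K) that kills every
polynomial of degree at most n in the numbers of (n-1)-vertex subgraphs; the numbers of induced ones
are linear in these. Take j₀ in the support of the relation whose deck has the most edges. If its
deck has m_t cards of type t, the product of the falling factorials of length m_t in the induced
counts d_t has degree n. It is nonzero only where the deck of G_{j₀} embeds in that of K, which
forces (j, K) = (j₀, ⊤) or a G_j with more deck edges (`recon_or_deckSize_lt`). Only the term (j₀,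
⊤) survives, a contradiction. -/

open Function

/-! ### Embeddings and subgraphs -/

namespace EdgeEnds

theorem support_map {V W : Type} (f : V → W) (d : EdgeEnds V) :
    (d.map f).support = f '' d.support := by
  cases d <;> simp [map, support, Set.image_pair]

theorem map_injective {V W : Type} {f : V → W} (hf : Injective f) : Injective (map f) := by
  rintro (s | ⟨a, b⟩) (t | ⟨c, d⟩) h
  · simpa [map, hf.image_injective.eq_iff] using h
  · simp [map] at h
  · simp [map] at h
  · simpa [map, hf.eq_iff] using h

theorem map_val_restrict {V : Type} (S : Set V) (d : EdgeEnds V) (h : d.support ⊆ S) :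
    (d.restrict S h).map Subtype.val = d := by
  cases d with
  | hyper s => exact congrArg hyper ((Subtype.image_preimage_coe S s).trans
      (Set.inter_eq_right.2 h))
  | arc t u => rfl

end EdgeEnds

namespace FinGraph

instance (G : FinGraph) : Finite G.V := G.finV

instance (G : FinGraph) : Finite G.E := G.finE

/-- The number of edges. -/
noncomputable def size (G : FinGraph) : ℕ := Nat.card G.E

theorem Iso.order_eq {G H : FinGraph} (h : G.Iso H) : G.order = H.order := by
  obtain ⟨f, -, -⟩ := h
  exact Nat.card_congr f

theorem Iso.size_eq {G H : FinGraph} (h : G.Iso H) : G.size = H.size := by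
  obtain ⟨-, g, -⟩ := h
  exact Nat.card_congr g

/-- The inclusion of the vertices of a subgraph. -/
def Sub.inclV {G : FinGraph} (S : G.Sub) : S.toGraph.V → G.V := Subtype.val

/-- The inclusion of the edges of a subgraph. -/
def Sub.inclE {G : FinGraph} (S : G.Sub) : S.toGraph.E → G.E := Subtype.val

theorem Sub.inclV_injective {G : FinGraph} (S : G.Sub) : Injective S.inclV :=
  Subtype.val_injective

theorem Sub.inclE_injective {G : FinGraph} (S : G.Sub) : Injective S.inclE :=
  Subtype.val_injective

theorem Sub.range_inclV {G : FinGraph} (S : G.Sub) : Set.range S.inclV = S.verts :=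
  Subtype.range_val

theorem Sub.range_inclE {G : FinGraph} (S : G.Sub) : Set.range S.inclE = S.edges :=
  Subtype.range_val

theorem Sub.ends_inclE {G : FinGraph} (S : G.Sub) (e : S.toGraph.E) :
    G.ends (S.inclE e) = (S.toGraph.ends e).map S.inclV :=
  (EdgeEnds.map_val_restrict _ _ (S.closed _ e.2)).symm

/-- `X` is mapped isomorphically onto the subgraph `S` of `G` by `f` and `g`. -/
structure IsEmbedding {X G : FinGraph} (S : G.Sub) (f : X.V → G.V) (g : X.E → G.E) : Prop where
  injective_verts : Injective f
  injective_edges : Injective g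
  range_verts : Set.range f = S.verts
  range_edges : Set.range g = S.edges
  ends_map : ∀ e, G.ends (g e) = (X.ends e).map f

theorem IsEmbedding.iso {X G : FinGraph} {S : G.Sub} {f : X.V → G.V} {g : X.E → G.E}
    (h : IsEmbedding S f g) : S.toGraph.Iso X := by
  let f' : X.V ≃ S.toGraph.V :=
    (Equiv.ofInjective f h.injective_verts).trans (Equiv.setCongr h.range_verts)
  let g' : X.E ≃ S.toGraph.E :=
    (Equiv.ofInjective g h.injective_edges).trans (Equiv.setCongr h.range_edges)
  refine Iso.symm ⟨f', g', fun e => EdgeEnds.map_injective S.inclV_injective ?_⟩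
  rw [EdgeEnds.map_map, ← S.ends_inclE]
  exact h.ends_map e

theorem Iso.exists_isEmbedding {X G : FinGraph} {S : G.Sub} (h : S.toGraph.Iso X) :
    ∃ (f : X.V → G.V) (g : X.E → G.E), IsEmbedding S f g := by
  obtain ⟨f, g, hfg⟩ := h.symm
  refine ⟨S.inclV ∘ f, S.inclE ∘ g, S.inclV_injective.comp f.injective,
    S.inclE_injective.comp g.injective, ?_, ?_, fun e => ?_⟩
  · rw [f.surjective.range_comp, S.range_inclV]
  · rw [g.surjective.range_comp, S.range_inclE]
  · rw [comp_apply, S.ends_inclE, hfg, EdgeEnds.map_map]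

namespace Sub

instance (G : FinGraph) : PartialOrder G.Sub :=
  PartialOrder.lift (fun S => (S.verts, S.edges)) fun _ _ h =>
    Sub.ext (congrArg Prod.fst h) (congrArg Prod.snd h)

theorem le_iff {G : FinGraph} {S T : G.Sub} : S ≤ T ↔ S.verts ⊆ T.verts ∧ S.edges ⊆ T.edges :=
  Iff.rfl

instance (G : FinGraph) : OrderTop G.Sub where
  top := ⟨Set.univ, Set.univ, fun _ _ => Set.subset_univ _⟩
  le_top _ := ⟨Set.subset_univ _, Set.subset_univ _⟩

@[simp] theorem verts_top (G : FinGraph) : (⊤ : G.Sub).verts = Set.univ := rfl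

@[simp] theorem edges_top (G : FinGraph) : (⊤ : G.Sub).edges = Set.univ := rfl

instance (G : FinGraph) : OrderBot G.Sub where
  bot := ⟨∅, ∅, fun _ h => h.elim⟩
  bot_le _ := ⟨Set.empty_subset _, Set.empty_subset _⟩

instance (G : FinGraph) : Finite G.Sub :=
  Finite.of_injective (fun S : G.Sub => (S.verts, S.edges)) fun _ _ h =>
    Sub.ext (congrArg Prod.fst h) (congrArg Prod.snd h)

theorem order_toGraph {G : FinGraph} (S : G.Sub) : S.toGraph.order = S.verts.ncard :=
  Nat.card_coe_set_eq _

theorem size_toGraph {G : FinGraph} (S : G.Sub) : S.toGraph.size = S.edges.ncard :=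
  Nat.card_coe_set_eq _

theorem toGraph_top_iso (G : FinGraph) : (⊤ : G.Sub).toGraph.Iso G :=
  IsEmbedding.iso (f := id) (g := id) ⟨injective_id, injective_id, Set.range_id, Set.range_id,
    fun _ => (EdgeEnds.map_id _).symm⟩

theorem size_le {G : FinGraph} (S : G.Sub) : S.toGraph.size ≤ G.size := by
  rw [size_toGraph]; exact Set.ncard_le_card _

theorem eq_top_of_order_eq_of_size_eq {G : FinGraph} {S : G.Sub}
    (hv : S.toGraph.order = G.order) (he : S.toGraph.size = G.size) : S = ⊤ := by
  rw [order_toGraph] at hv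
  rw [size_toGraph] at he
  exact Sub.ext ((Set.eq_univ_iff_ncard _).2 hv) ((Set.eq_univ_iff_ncard _).2 he)

/-- The image of a subgraph under an embedding. -/
def push {Y G : FinGraph} {S : G.Sub} {f : Y.V → G.V} {g : Y.E → G.E}
    (h : IsEmbedding S f g) (T : Y.Sub) : G.Sub where
  verts := f '' T.verts
  edges := g '' T.edges
  closed := by
    rintro _ ⟨e, he, rfl⟩
    rw [h.ends_map, EdgeEnds.support_map]
    exact Set.image_mono (T.closed e he)

theorem push_iso {Y G : FinGraph} {S : G.Sub} {f : Y.V → G.V} {g : Y.E → G.E}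
    (h : IsEmbedding S f g) (T : Y.Sub) : (push h T).toGraph.Iso T.toGraph := by
  refine IsEmbedding.iso (f := f ∘ T.inclV) (g := g ∘ T.inclE)
    ⟨h.injective_verts.comp T.inclV_injective, h.injective_edges.comp T.inclE_injective,
      ?_, ?_, fun e => ?_⟩
  · rw [Set.range_comp, T.range_inclV]; rfl
  · rw [Set.range_comp, T.range_inclE]; rfl
  · rw [comp_apply, h.ends_map, T.ends_inclE, EdgeEnds.map_map]

/-- The vertex-deleted subgraph as a subgraph. -/
def delete {G : FinGraph} (v : G.V) : G.Sub where
  verts := {v}ᶜ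
  edges := {e | v ∉ (G.ends e).support}
  closed _ he _ hx hxv := he (Set.mem_singleton_iff.mp hxv ▸ hx)

end Sub

theorem del_iso_del {G H : FinGraph} {f : G.V ≃ H.V} {g : G.E ≃ H.E}
    (h : ∀ e, H.ends (g e) = (G.ends e).map f) (v : G.V) : (G.del v).Iso (H.del (f v)) := by
  refine Iso.symm (IsEmbedding.iso (X := (Sub.delete v).toGraph)
    (S := Sub.delete (f v)) (f := f ∘ (Sub.delete v).inclV)
    (g := g ∘ (Sub.delete v).inclE)
    ⟨f.injective.comp (Sub.inclV_injective _), g.injective.comp (Sub.inclE_injective _),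
      ?_, ?_, fun e => ?_⟩)
  · rw [Set.range_comp, Sub.range_inclV, Sub.delete, Set.image_compl_eq f.bijective,
      Set.image_singleton]
    rfl
  · rw [Set.range_comp, Sub.range_inclE]
    ext e
    obtain ⟨e, rfl⟩ := g.surjective e
    simp [Sub.delete, h, EdgeEnds.support_map]
  · rw [comp_apply, h, Sub.ends_inclE, EdgeEnds.map_map]

theorem Iso.recon {G H : FinGraph} : G.Iso H → G.Recon H := by
  rintro ⟨f, g, h⟩
  exact ⟨f, del_iso_del h⟩

end FinGraph

/-! ### Subgraph numbers and the invertibility of their matrix -/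

open FinGraph

/-- Subgraphs of a subgraph are counted by `subCount`. -/
theorem card_le_iso_eq_subCount {G : FinGraph} (X : FinGraph) {Y : FinGraph} {S : G.Sub}
    (hS : S.toGraph.Iso Y) :
    Nat.card {T : G.Sub // T ≤ S ∧ T.toGraph.Iso X} = subCount X Y := by
  obtain ⟨f, g, h⟩ := hS.exists_isEmbedding
  have hle (T : Y.Sub) : Sub.push h T ≤ S :=
    Sub.le_iff.2 ⟨h.range_verts.subset.trans' (Set.image_subset_range f T.verts),
      h.range_edges.subset.trans' (Set.image_subset_range g T.edges)⟩
  refine (Nat.card_congr (Equiv.ofBijective (fun T : {T : Y.Sub // T.toGraph.Iso X} =>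
    ⟨Sub.push h T.1, hle T.1, (Sub.push_iso h T.1).trans T.2⟩) ⟨?_, ?_⟩)).symm
  · intro T T' hT
    have hT := congrArg Subtype.val hT
    exact Subtype.ext (Sub.ext
      (h.injective_verts.image_injective (congrArg Sub.verts hT))
      (h.injective_edges.image_injective (congrArg Sub.edges hT)))
  · rintro ⟨T, hTS, hT⟩
    let T' : Y.Sub := ⟨f ⁻¹' T.verts, g ⁻¹' T.edges, fun e he => by
      have := T.closed _ he
      rwa [h.ends_map, EdgeEnds.support_map, Set.image_subset_iff] at this⟩
    have hT' : Sub.push h T' = T := by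
      refine Sub.ext ?_ ?_
      · exact Set.image_preimage_eq_of_subset (h.range_verts ▸ hTS.1)
      · exact Set.image_preimage_eq_of_subset (h.range_edges ▸ hTS.2)
    exact ⟨⟨T', (Sub.push_iso h T').symm.trans (hT' ▸ hT)⟩, Subtype.ext hT'⟩

theorem subCount_self (X : FinGraph) : subCount X X = 1 := by
  rw [subCount, Nat.card_eq_one_iff_exists]
  refine ⟨⟨⊤, Sub.toGraph_top_iso X⟩, fun S => Subtype.ext ?_⟩
  exact Sub.eq_top_of_order_eq_of_size_eq S.2.order_eq S.2.size_eq

/-- A copy of `X` with all the vertices and all the edges of `Y` would be `Y` itself. This is the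
triangularity of the matrix of subgraph numbers. -/
theorem size_lt_of_subCount_ne_zero {X Y : FinGraph} (h : subCount X Y ≠ 0)
    (hXY : X.order = Y.order) (hiso : ¬ X.Iso Y) : X.size < Y.size := by
  obtain ⟨⟨S, hS⟩⟩ := (Nat.card_ne_zero.1 h).1
  refine lt_of_le_of_ne (hS.size_eq ▸ S.size_le) fun he => hiso ?_
  have := Sub.eq_top_of_order_eq_of_size_eq (hS.order_eq.trans hXY) (hS.size_eq.trans he)
  subst this
  exact hS.symm.trans (Sub.toGraph_top_iso Y)

/-- The matrix of subgraph numbers of pairwise non-isomorphic graphs of the same order is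
invertible. -/
theorem isUnit_subCount_matrix {T : Type*} [Fintype T] [DecidableEq T] (Y : T → FinGraph) (m : ℕ)
    (horder : ∀ t, (Y t).order = m) (hiso : ∀ t t', (Y t).Iso (Y t') → t = t') :
    IsUnit (Matrix.of fun t t' => (subCount (Y t) (Y t') : ℝ)) := by
  rw [← Matrix.mulVec_injective_iff_isUnit]
  refine (injective_iff_map_eq_zero (Matrix.mulVecLin _)).2 fun y hy => ?_
  by_contra hne
  have hex : ((Finset.univ.filter fun t => y t ≠ 0)).Nonempty := by
    obtain ⟨t, ht⟩ := Function.ne_iff.1 hne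
    exact ⟨t, by simpa using ht⟩
  -- In row `t`, an off-diagonal nonzero entry belongs to a graph with more edges, where `y`
  -- vanishes by maximality; the diagonal entry is 1.
  obtain ⟨t, ht, hmax⟩ := Finset.exists_max_image _ (fun t => (Y t).size) hex
  have h1 := congrFun hy t
  rw [Matrix.mulVecLin_apply, Matrix.mulVec, dotProduct, Finset.sum_eq_single t] at h1
  · simp [subCount_self] at h1
    exact (Finset.mem_filter.1 ht).2 h1
  · intro t' _ htt'
    by_contra hz
    have hz' := mul_ne_zero_iff.1 hz
    refine (hmax t' (by simpa using hz'.2)).not_gt (size_lt_of_subCount_ne_zero ?_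
      ((horder t).trans (horder t').symm) fun h => htt' (hiso _ _ h).symm)
    simpa using hz'.1
  · simp

/-! ### Möbius inversion of covering numbers -/

open scoped Classical in
noncomputable instance (G : FinGraph) : Fintype G.Sub := Fintype.ofFinite _

noncomputable instance (G : FinGraph) : Fintype G.V := Fintype.ofFinite _

/-- The number of subgraphs of the subgraph `K` isomorphic to `X`. -/
noncomputable def countBelow (X : FinGraph) {G : FinGraph} (K : G.Sub) : ℕ :=
  Nat.card {S : G.Sub // S ≤ K ∧ S.toGraph.Iso X}

open scoped Classical in
theorem countBelow_eq_card (X : FinGraph) {G : FinGraph} (K : G.Sub) :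
    countBelow X K = (Finset.univ.filter fun S : G.Sub => S ≤ K ∧ S.toGraph.Iso X).card := by
  rw [countBelow, Nat.card_eq_fintype_card, Fintype.card_subtype]

/-- The union of a family of subgraphs. -/
def FinGraph.Sub.iUnion {G : FinGraph} {ι : Type*} (S : ι → G.Sub) : G.Sub where
  verts := ⋃ i, (S i).verts
  edges := ⋃ i, (S i).edges
  closed e he := by
    obtain ⟨i, hi⟩ := Set.mem_iUnion.1 he
    exact ((S i).closed e hi).trans (Set.subset_iUnion (fun i => (S i).verts) i)

theorem FinGraph.Sub.iUnion_le {G : FinGraph} {ι : Type*} {S : ι → G.Sub} {K : G.Sub} :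
    Sub.iUnion S ≤ K ↔ ∀ i, S i ≤ K := by
  simp only [Sub.le_iff, Sub.iUnion, Set.iUnion_subset_iff, forall_and]

theorem isCover_iff {F : List FinGraph} {G : FinGraph} {S : Fin F.length → G.Sub} :
    IsCover F G S ↔ (∀ i, (S i).toGraph.Iso (F.get i)) ∧ Sub.iUnion S = ⊤ := by
  rw [IsCover, Sub.ext_iff]
  rfl

open scoped Classical in
/-- Kocay's counting argument inside a fixed graph, inverted: the covering number of `G` is a
combination of products of subgraph numbers of the subgraphs of `G`. -/
theorem exists_coverCount_eq_sum (G : FinGraph) :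
    ∃ μ : G.Sub → ℝ, μ ⊤ = 1 ∧ ∀ F : List FinGraph,
      (coverCount F G : ℝ) = ∑ K, μ K * (F.map fun X => (countBelow X K : ℝ)).prod := by
  let : LocallyFiniteOrder G.Sub := Fintype.toLocallyFiniteOrder
  -- A union lies below `K` iff every term does, so the product counts the sequences of copies with
  -- union below `K`; inversion extracts those with union exactly `⊤`.
  refine ⟨fun K => IncidenceAlgebra.mu ℝ K ⊤, IncidenceAlgebra.mu_self _, fun F => ?_⟩
  let 𝒮 : Finset (Fin F.length → G.Sub) :=
    Finset.univ.filter fun S => ∀ i, (S i).toGraph.Iso (F.get i)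
  have h1 (K : G.Sub) : (F.map fun X => (countBelow X K : ℝ)).prod =
      ∑ K' ∈ Finset.Iic K, ((𝒮.filter fun S => Sub.iUnion S = K').card : ℝ) := by
    have h2 : (F.map fun X => countBelow X K).prod = (𝒮.filter fun S => Sub.iUnion S ≤ K).card := by
      have h3 : (𝒮.filter fun S => Sub.iUnion S ≤ K) = Fintype.piFinset fun i =>
          Finset.univ.filter fun S : G.Sub => S ≤ K ∧ S.toGraph.Iso (F.get i) := by
        ext S
        simp only [𝒮, Finset.mem_filter, Finset.mem_univ, true_and, Sub.iUnion_le,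
          Fintype.mem_piFinset, forall_and]
        exact and_comm
      rw [h3, Fintype.card_piFinset, ← List.prod_ofFn]
      simp_rw [← countBelow_eq_card]
      congr 1
      conv_lhs => rw [← List.ofFn_get F, List.map_ofFn]
      rfl
    have h4 : ((𝒮.filter fun S => Sub.iUnion S ≤ K).card : ℝ) =
        ∑ K' ∈ Finset.Iic K, ((𝒮.filter fun S => Sub.iUnion S = K').card : ℝ) := by
      rw [Finset.card_eq_sum_card_fiberwise (f := fun S => Sub.iUnion S) (t := Finset.Iic K)
        fun S hS => Finset.mem_coe.2 (Finset.mem_Iic.2 (Finset.mem_filter.1 hS).2), Nat.cast_sum]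
      refine Finset.sum_congr rfl fun K' hK' => ?_
      rw [Finset.filter_filter]
      congr 2
      refine Finset.filter_congr fun S _ => ?_
      exact ⟨fun h => h.2, fun h => ⟨h.trans_le (Finset.mem_Iic.1 hK'), h⟩⟩
    rw [← h4, ← h2, Nat.cast_list_prod, List.map_map]
    rfl
  have h5 := IncidenceAlgebra.moebius_inversion_bot (𝕜 := ℝ)
    (fun K' => ((𝒮.filter fun S => Sub.iUnion S = K').card : ℝ)) _ h1 ⊤
  have h6 : (coverCount F G : ℝ) = ((𝒮.filter fun S => Sub.iUnion S = ⊤).card : ℝ) := by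
    rw [coverCount, Nat.card_eq_fintype_card, Fintype.card_subtype, Finset.filter_filter]
    simp_rw [isCover_iff]
  rw [h6, h5, Finset.Iic_top]

/-! ### Subgraphs on `n - 1` vertices -/

namespace FinGraph

/-- The subgraph of `K` induced by a set of vertices. -/
def Sub.induce {G : FinGraph} (K : G.Sub) (U : Set G.V) : G.Sub where
  verts := K.verts ∩ U
  edges := {e | e ∈ K.edges ∧ (G.ends e).support ⊆ U}
  closed _ he := Set.subset_inter (K.closed _ he.1) he.2

open scoped Classical in
/-- The sets of `n - 1` vertices of `K`. -/
noncomputable def Sub.cardSets (n : ℕ) {G : FinGraph} (K : G.Sub) : Finset (Set G.V) :=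
  Finset.univ.filter fun U => U ⊆ K.verts ∧ U.ncard + 1 = n

theorem Sub.mem_cardSets {n : ℕ} {G : FinGraph} {K : G.Sub} {U : Set G.V} :
    U ∈ K.cardSets n ↔ U ⊆ K.verts ∧ U.ncard + 1 = n := by
  simp [Sub.cardSets]

theorem Sub.order_induce {n : ℕ} {G : FinGraph} {K : G.Sub} {U : Set G.V}
    (h : U ∈ K.cardSets n) : (K.induce U).toGraph.order + 1 = n := by
  have hU : (K.induce U).verts = U := Set.inter_eq_right.2 (Sub.mem_cardSets.1 h).1
  rw [Sub.order_toGraph, hU]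
  exact (Sub.mem_cardSets.1 h).2

theorem Sub.induce_top_compl {G : FinGraph} (v : G.V) :
    (⊤ : G.Sub).induce {v}ᶜ = Sub.delete v := by
  refine Sub.ext (Set.univ_inter _) ?_
  ext e
  simp [Sub.induce, Sub.delete]

end FinGraph

open scoped Classical in
/-- Subgraphs with `n - 1` vertices are counted by their vertex sets. -/
theorem countBelow_eq_sum {n : ℕ} {X G : FinGraph} (hX : X.order + 1 = n) (K : G.Sub) :
    countBelow X K = ∑ U ∈ K.cardSets n, subCount X (K.induce U).toGraph := by
  rw [countBelow_eq_card, Finset.card_eq_sum_card_fiberwise (f := fun S : G.Sub => S.verts)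
    (t := K.cardSets n)]
  · refine Finset.sum_congr rfl fun U hU => ?_
    rw [← card_le_iso_eq_subCount X (Iso.refl (K.induce U).toGraph), Nat.card_eq_fintype_card,
      Fintype.card_subtype, Finset.filter_filter]
    congr 1
    refine Finset.filter_congr fun S _ => ?_
    rw [Sub.mem_cardSets] at hU
    constructor
    · rintro ⟨⟨h, hS⟩, rfl⟩
      exact ⟨⟨Set.subset_inter h.1 subset_rfl, fun e he => ⟨h.2 he, S.closed e he⟩⟩, hS⟩
    · rintro ⟨h, hS⟩
      have hv : S.verts ⊆ U := fun v hv => (h.1 hv).2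
      refine ⟨⟨⟨fun v hv => (h.1 hv).1, fun e he => (h.2 he).1⟩, hS⟩, ?_⟩
      refine Set.eq_of_subset_of_ncard_le hv ?_
      rw [← Sub.order_toGraph, hS.order_eq]
      omega
  · intro S hS
    have hS := (Finset.mem_filter.1 hS).2
    refine Finset.mem_coe.2 (Sub.mem_cardSets.2 ⟨hS.1.1, ?_⟩)
    rw [← Sub.order_toGraph, hS.2.order_eq, hX]

/-- A finite family of graphs has a finite transversal of isomorphism types. -/
theorem exists_iso_transversal {ι : Type*} [Finite ι] (𝒢 : ι → FinGraph) :
    ∃ T : Finset ι, (∀ t ∈ T, ∀ t' ∈ T, (𝒢 t).Iso (𝒢 t') → t = t') ∧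
      ∀ i, ∃ t ∈ T, (𝒢 i).Iso (𝒢 t) := by
  let s : Setoid ι := ⟨fun i j => (𝒢 i).Iso (𝒢 j), fun i => Iso.refl _, Iso.symm, Iso.trans⟩
  refine ⟨(Set.toFinite (Set.range (Quotient.out : Quotient s → ι))).toFinset, ?_, fun i => ?_⟩
  · simp only [Set.Finite.mem_toFinset, Set.mem_range]
    rintro _ ⟨q, rfl⟩ _ ⟨q', rfl⟩ h
    exact congrArg Quotient.out (Quotient.out_equiv_out (s := s).1 h)
  · refine ⟨(Quotient.mk s i).out, by simp, ?_⟩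
    exact Iso.symm (Quotient.exact (s := s) (Quotient.out_eq (Quotient.mk s i)))

/-! ### Polynomials in the subgraph numbers, filtered by degree -/

section Family

variable {J : Type*} (G : J → FinGraph)

/-- The span of the products of at most `k` numbers of subgraphs with `n - 1` vertices, as
functions of the subgraphs of the graphs `G j`. -/
def cardProducts (n k : ℕ) : Submodule ℝ ((Σ j, (G j).Sub) → ℝ) :=
  Submodule.span ℝ {h | ∃ F : List FinGraph, F.length ≤ k ∧ (∀ X ∈ F, X.order + 1 = n) ∧
    h = fun ω => (F.map fun X => (countBelow X ω.2 : ℝ)).prod}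

variable {G}

theorem one_mem_cardProducts (n k : ℕ) : 1 ∈ cardProducts G n k :=
  Submodule.subset_span ⟨[], by simp, by simp, by ext; simp⟩

theorem countBelow_mem_cardProducts {n : ℕ} {X : FinGraph} (hX : X.order + 1 = n) :
    (fun ω => (countBelow X ω.2 : ℝ)) ∈ cardProducts G n 1 :=
  Submodule.subset_span ⟨[X], by simp, by simpa using hX, by ext; simp⟩

theorem mul_mem_cardProducts {n a b : ℕ} {f g : (Σ j, (G j).Sub) → ℝ}
    (hf : f ∈ cardProducts G n a) (hg : g ∈ cardProducts G n b) :
    f * g ∈ cardProducts G n (a + b) := by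
  have h := Submodule.mul_mem_mul hf hg
  rw [cardProducts, cardProducts, Submodule.span_mul_span] at h
  refine Submodule.span_mono ?_ h
  rintro _ ⟨_, ⟨F, hF, hF', rfl⟩, _, ⟨F', hF₂, hF₂', rfl⟩, rfl⟩
  refine ⟨F ++ F', by rw [List.length_append]; omega, fun X hX => ?_, ?_⟩
  · exact (List.mem_append.1 hX).elim (hF' X) (hF₂' X)
  · ext ω
    simp

theorem prod_mem_cardProducts {n : ℕ} {ι : Type*} (s : Finset ι) (m : ι → ℕ)
    (f : ι → (Σ j, (G j).Sub) → ℝ) (h : ∀ i ∈ s, f i ∈ cardProducts G n (m i)) :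
    ∏ i ∈ s, f i ∈ cardProducts G n (∑ i ∈ s, m i) := by
  classical
  induction s using Finset.induction_on with
  | empty => exact one_mem_cardProducts n _
  | insert i s hi ih =>
    rw [Finset.prod_insert hi, Finset.sum_insert hi]
    exact mul_mem_cardProducts (h i (Finset.mem_insert_self i s))
      (ih fun k hk => h k (Finset.mem_insert_of_mem hk))

open scoped Classical in
/-- The number of `(n - 1)`-vertex induced subgraphs of `K` isomorphic to `X`. -/
noncomputable def inducedCount (n : ℕ) (X : FinGraph) {G : FinGraph} (K : G.Sub) : ℕ :=
  ((K.cardSets n).filter fun U => (K.induce U).toGraph.Iso X).card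

-- Grouping the `(n - 1)`-sets by the type they induce expresses the subgraph numbers as an
-- invertible matrix times the induced counts. The inverse is linear, so the degree stays 1; this is
-- what keeps the sequences of length at most `n`.
open scoped Classical in
theorem inducedCount_mem_cardProducts {n : ℕ} {T : Type*} [Fintype T] (Y : T → FinGraph)
    (horder : ∀ t, (Y t).order + 1 = n) (hiso : ∀ t t', (Y t).Iso (Y t') → t = t')
    (hY : ∀ j, ∀ S : (G j).Sub, S.toGraph.order + 1 = n → ∃ t, S.toGraph.Iso (Y t)) (t : T) :
    (fun ω => (inducedCount n (Y t) ω.2 : ℝ)) ∈ cardProducts G n 1 := by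
  let A : Matrix T T ℝ := Matrix.of fun t t' => (subCount (Y t) (Y t') : ℝ)
  have hA : IsUnit A.det := (Matrix.isUnit_iff_isUnit_det _).1
    (isUnit_subCount_matrix Y (n - 1) (fun t => by have := horder t; omega) hiso)
  have key (ω : Σ j, (G j).Sub) : (fun t => (countBelow (Y t) ω.2 : ℝ)) =
      A.mulVec fun t => (inducedCount n (Y t) ω.2 : ℝ) := by
    obtain ⟨j, K⟩ := ω
    ext t
    -- Off `K.cardSets n` the type is a dummy value, which makes `τ` a total function.
    have hex (U : Set (G j).V) : ∃ t', U ∈ K.cardSets n → (K.induce U).toGraph.Iso (Y t') := by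
      by_cases hU : U ∈ K.cardSets n
      · obtain ⟨t', ht'⟩ := hY j _ (Sub.order_induce hU)
        exact ⟨t', fun _ => ht'⟩
      · exact ⟨t, fun h => (hU h).elim⟩
    choose τ hτ using hex
    rw [countBelow_eq_sum (horder t), ← Finset.sum_fiberwise (K.cardSets n) τ]
    push_cast
    refine Finset.sum_congr rfl fun t' _ => ?_
    have hfil : ((K.cardSets n).filter fun U => τ U = t') =
        (K.cardSets n).filter fun U => (K.induce U).toGraph.Iso (Y t') := by
      refine Finset.filter_congr fun U hU => ?_
      exact ⟨fun h => h ▸ hτ U hU, fun h => hiso _ _ ((hτ U hU).symm.trans h)⟩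
    have hc : ∀ U ∈ (K.cardSets n).filter (fun U => (K.induce U).toGraph.Iso (Y t')),
        (subCount (Y t) (K.induce U).toGraph : ℝ) = A t t' := by
      intro U hU
      have h := (Finset.mem_filter.1 hU).2
      rw [← card_le_iso_eq_subCount _ (Iso.refl _), card_le_iso_eq_subCount _ h]
      rfl
    rw [hfil, Finset.sum_congr rfl hc, Finset.sum_const, nsmul_eq_mul, mul_comm]
    rfl
  have hinv : (fun ω : Σ j, (G j).Sub => (inducedCount n (Y t) ω.2 : ℝ)) =
      ∑ t', A⁻¹ t t' • fun ω => (countBelow (Y t') ω.2 : ℝ) := by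
    ext ω
    have h := congrArg A⁻¹.mulVec (key ω)
    rw [Matrix.mulVec_mulVec, Matrix.nonsing_inv_mul _ hA, Matrix.one_mulVec] at h
    rw [← congrFun h t, Finset.sum_apply]
    rfl
  rw [hinv]
  exact Submodule.sum_mem _ fun t' _ =>
    Submodule.smul_mem _ _ (countBelow_mem_cardProducts (horder t'))

end Family

/-! ### Comparing and matching decks -/

/-- The total number of edges of the vertex-deleted subgraphs. -/
noncomputable def deckSize (G : FinGraph) : ℕ := ∑ v : G.V, (G.del v).size

/-- A proper spanning subgraph misses an edge, and an edge that is not big survives in the card of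
some vertex off it. No other card of `K` gains edges. -/
theorem deckSize_sub_lt {G : FinGraph} (hbig : G.NoBigEdge) {K : G.Sub}
    (hv : K.verts = Set.univ) (hK : K ≠ ⊤) :
    ∑ v : G.V, (K.induce {v}ᶜ).toGraph.size < deckSize G := by
  have hsub (v : G.V) : (K.induce {v}ᶜ).edges ⊆ (Sub.delete v).edges := fun e he =>
    Set.subset_compl_singleton_iff.1 he.2
  have hsize (v : G.V) : (G.del v).size = (Sub.delete v).edges.ncard := Sub.size_toGraph _
  obtain ⟨e, he⟩ : ∃ e, e ∉ K.edges := by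
    by_contra! h
    exact hK (Sub.ext hv (Set.eq_univ_of_forall h))
  obtain ⟨v, hve⟩ := (Set.ne_univ_iff_exists_notMem _).1 (hbig e)
  refine Finset.sum_lt_sum (fun u _ => ?_) ⟨v, Finset.mem_univ v, ?_⟩
  · rw [hsize, Sub.size_toGraph]
    exact Set.ncard_le_ncard (hsub u)
  · rw [hsize, Sub.size_toGraph]
    exact Set.ncard_lt_ncard ((Set.ssubset_iff_of_subset (hsub v)).2 ⟨e, hve, fun h => he h.1⟩)

/-- If the cards of `G₀` are matched with distinct cards of a subgraph `K` of `G`, then `K = G` is a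
reconstruction of `G₀`, or the cards of `G` have more edges than those of `G₀`. -/
theorem recon_or_deckSize_lt {n : ℕ} (hn : 2 ≤ n) {G₀ G : FinGraph} (h₀ : G₀.order = n)
    (hG : G.order = n) (hbig : G.NoBigEdge) {K : G.Sub} {f : G₀.V → Set G.V} (hf : Injective f)
    (hfK : ∀ v, f v ∈ K.cardSets n) (hiso : ∀ v, (K.induce (f v)).toGraph.Iso (G₀.del v)) :
    (K = ⊤ ∧ G₀.Recon G) ∨ deckSize G₀ < deckSize G := by
  have hex (v : G₀.V) : ∃ w, (f v)ᶜ = {w} := by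
    rw [← Set.ncard_eq_one]
    have h1 := (Sub.mem_cardSets.1 (hfK v)).2
    have h2 := Set.ncard_add_ncard_compl (f v)
    have h3 : Nat.card G.V = n := hG
    omega
  choose w hw using hex
  have hfw (v : G₀.V) : f v = {w v}ᶜ := by rw [← hw, compl_compl]
  have hwinj : Injective w := fun v v' h => hf (by rw [hfw, hfw, h])
  have hwbij : Bijective w :=
    hwinj.bijective_of_nat_card_le (hG.trans h₀.symm).le
  have hverts : K.verts = Set.univ := by
    refine Set.eq_univ_of_forall fun x => ?_
    -- As `n ≥ 2`, there is a second vertex `v`, whose matched set omits only `w v ≠ x` and so puts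
    -- `x` in `K`.
    have : Nontrivial G₀.V := Finite.one_lt_card_iff_nontrivial.1 (by
      have h3 : Nat.card G₀.V = n := h₀
      omega)
    obtain ⟨y, hy⟩ := hwbij.2 x
    obtain ⟨v, hv⟩ := exists_ne y
    refine (Sub.mem_cardSets.1 (hfK v)).1 ?_
    rw [hfw]
    exact fun h => hv (hwinj (hy.trans h).symm)
  simp_rw [hfw] at hiso
  by_cases hK : K = ⊤
  · subst hK
    refine Or.inl ⟨rfl, Equiv.ofBijective w hwbij, fun v => ?_⟩
    have := hiso v
    rw [Sub.induce_top_compl] at this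
    exact this.symm
  · refine Or.inr (lt_of_eq_of_lt ?_ (deckSize_sub_lt hbig hverts hK))
    rw [deckSize, ← hwbij.sum_comp fun v => (K.induce {v}ᶜ).toGraph.size]
    exact Finset.sum_congr rfl fun v _ => (hiso v).size_eq.symm

theorem FinGraph.order_del {G : FinGraph} (v : G.V) : (G.del v).order + 1 = G.order := by
  have h1 : (G.del v).order = ({v}ᶜ : Set G.V).ncard := Sub.order_toGraph (Sub.delete v)
  have h2 := Set.ncard_add_ncard_compl ({v} : Set G.V)
  rw [Set.ncard_singleton] at h2
  rw [h1, FinGraph.order]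
  omega

open scoped Classical in
/-- The number of vertices whose deletion leaves a copy of `X`. -/
noncomputable def cardCount (X G : FinGraph) : ℕ :=
  (Finset.univ.filter fun v => (G.del v).Iso X).card

theorem cardCount_le_inducedCount_top {n : ℕ} (X : FinGraph) {G : FinGraph} (hG : G.order = n) :
    cardCount X G ≤ inducedCount n X (⊤ : G.Sub) := by
  classical
  refine Finset.card_le_card_of_injOn (fun v => {v}ᶜ) (fun v hv => ?_) fun v _ w _ h => ?_
  · refine Finset.mem_coe.2 (Finset.mem_filter.2 ⟨Sub.mem_cardSets.2 ⟨Set.subset_univ _, ?_⟩, ?_⟩)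
    · have h2 := Set.ncard_add_ncard_compl ({v} : Set G.V)
      rw [Set.ncard_singleton] at h2
      have h3 : Nat.card G.V = n := hG
      change ({v}ᶜ : Set G.V).ncard + 1 = n
      omega
    · rw [Sub.induce_top_compl]
      exact (Finset.mem_filter.1 hv).2
  · exact Set.singleton_injective (compl_injective h)

/-- A graph with at least as many cards of every type as `G₀` has its cards matched with those
of `G₀`. -/
theorem exists_injective_of_cardCount_le {n : ℕ} {T : Type*} {Y : T → FinGraph}
    {G₀ G : FinGraph} {K : G.Sub} (hiso : ∀ t t', (Y t).Iso (Y t') → t = t')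
    (hY : ∀ v, ∃ t, (G₀.del v).Iso (Y t))
    (hle : ∀ t, cardCount (Y t) G₀ ≤ inducedCount n (Y t) K) :
    ∃ f : G₀.V → Set G.V, Injective f ∧ (∀ v, f v ∈ K.cardSets n) ∧
      ∀ v, (K.induce (f v)).toGraph.Iso (G₀.del v) := by
  classical
  -- Cards are matched type by type; the glued map is injective because sets inducing different
  -- types are distinct.
  have hemb (t : T) : Nonempty ({v // (G₀.del v).Iso (Y t)} ↪
      {U // U ∈ (K.cardSets n).filter fun U => (K.induce U).toGraph.Iso (Y t)}) := by
    apply Function.Embedding.nonempty_of_card_le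
    rw [Fintype.card_subtype, Fintype.card_coe]
    exact hle t
  choose τ hτ using hY
  have e (t : T) := (hemb t).some
  have he (v : G₀.V) := Finset.mem_filter.1 (e (τ v) ⟨v, hτ v⟩).2
  refine ⟨fun v => (e (τ v) ⟨v, hτ v⟩).1, fun v v' h => ?_, fun v => (he v).1,
    fun v => (he v).2.trans (hτ v).symm⟩
  -- The types are variables here, so that their equality can be substituted.
  have aux (t t' : T) (x : {v // (G₀.del v).Iso (Y t)}) (x' : {v // (G₀.del v).Iso (Y t')})
      (hxx : (e t x).1 = (e t' x').1) : x.1 = x'.1 := by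
    obtain rfl : t = t' := hiso _ _ <|
      (Finset.mem_filter.1 (e t x).2).2.symm.trans (hxx ▸ (Finset.mem_filter.1 (e t' x').2).2)
    rw [(e t).injective (Subtype.ext hxx)]
  exact aux _ _ _ _ h

/-- Each card has exactly one type. The sum is the degree of the test polynomial. -/
theorem sum_cardCount {T : Type*} [Fintype T] {Y : T → FinGraph} {G : FinGraph}
    (hiso : ∀ t t', (Y t).Iso (Y t') → t = t') (hY : ∀ v, ∃ t, (G.del v).Iso (Y t)) :
    ∑ t, cardCount (Y t) G = G.order := by
  classical
  choose τ hτ using hY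
  rw [FinGraph.order, Nat.card_eq_fintype_card, ← Finset.card_univ,
    Finset.card_eq_sum_card_fiberwise (f := τ) (t := Finset.univ) (fun _ _ => by simp)]
  refine Finset.sum_congr rfl fun t _ => congrArg _ (Finset.filter_congr fun v _ => ?_)
  exact ⟨fun h => hiso _ _ ((hτ v).symm.trans h), fun h => h ▸ hτ v⟩

/-! ### Linear independence of the covering numbers -/

open scoped Classical in
/-- The covering numbers, as functions of the sequence of cards, of pairwise
reconstruction-inequivalent graphs without big edges are linearly independent. -/
theorem eq_zero_of_sum_coverCount_eq_zero {n : ℕ} (hn : 2 ≤ n) {J : Type*} [Fintype J]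
    (G : J → FinGraph) (horder : ∀ j, (G j).order = n) (hbig : ∀ j, (G j).NoBigEdge)
    (hrecon : ∀ i j, (G i).Recon (G j) → i = j) (a : J → ℝ)
    (ha : ∀ F, IsCardSeq n F → ∑ j, a j * (coverCount F (G j) : ℝ) = 0) : a = 0 := by
  by_contra hne
  have hex : (Finset.univ.filter fun j => a j ≠ 0).Nonempty := by
    obtain ⟨j, hj⟩ := Function.ne_iff.1 hne
    exact ⟨j, by simpa using hj⟩
  -- Extremal choice: `a` vanishes on every graph with a larger deck size.
  obtain ⟨j₀, hj₀, hmax⟩ := Finset.exists_max_image _ (fun j => deckSize (G j)) hex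
  have hj₀ := (Finset.mem_filter.1 hj₀).2
  obtain ⟨T, hTiso, hT⟩ := exists_iso_transversal
    fun u : {u : Σ j, (G j).Sub // u.2.toGraph.order + 1 = n} => u.1.2.toGraph
  let Y : T → FinGraph := fun t => t.1.1.2.toGraph
  have hYorder (t : T) : (Y t).order + 1 = n := t.1.2
  have hYiso (t t' : T) (h : (Y t).Iso (Y t')) : t = t' := Subtype.ext (hTiso _ t.2 _ t'.2 h)
  have hY (j : J) (S : (G j).Sub) (hS : S.toGraph.order + 1 = n) : ∃ t, S.toGraph.Iso (Y t) := by
    obtain ⟨t, ht, h⟩ := hT ⟨⟨j, S⟩, hS⟩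
    exact ⟨⟨t, ht⟩, h⟩
  have hdel (v : (G j₀).V) : ∃ t, ((G j₀).del v).Iso (Y t) :=
    hY j₀ (Sub.delete v) ((order_del v).trans (horder j₀))
  choose μ hμtop hμ using fun j => exists_coverCount_eq_sum (G j)
  -- The relation, extended by linearity from sequences to all polynomials of degree at most `n`.
  have hkill : ∀ h ∈ cardProducts G n n, ∑ j, a j * ∑ K, μ j K * h ⟨j, K⟩ = 0 := by
    intro h hh
    induction hh using Submodule.span_induction with
    | mem h hh =>
      obtain ⟨F, hF, hF', rfl⟩ := hh
      rw [← ha F ⟨hF, hF'⟩]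
      exact Finset.sum_congr rfl fun j _ => by rw [hμ]
    | zero => simp
    | add f g _ _ hf hg =>
      simp only [Pi.add_apply, mul_add, Finset.sum_add_distrib, hf, hg, add_zero]
    | smul c f _ hf =>
      simp only [Pi.smul_apply, smul_eq_mul, mul_left_comm _ c, ← Finset.mul_sum, hf, mul_zero]
  let d (t : T) : (Σ j, (G j).Sub) → ℝ := fun ω => inducedCount n (Y t) ω.2
  -- A product of falling factorials: since counts are natural numbers, it vanishes at `K` unless
  -- `K` has at least as many cards of each type as `G j₀`.
  let p : (Σ j, (G j).Sub) → ℝ :=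
    ∏ t, ∏ k ∈ Finset.range (cardCount (Y t) (G j₀)), (d t - (k : ℝ) • 1)
  have hp : p ∈ cardProducts G n n := by
    have h := prod_mem_cardProducts (G := G) (n := n) Finset.univ
      (fun t => ∑ k ∈ Finset.range (cardCount (Y t) (G j₀)), 1)
      (fun t => ∏ k ∈ Finset.range (cardCount (Y t) (G j₀)), (d t - (k : ℝ) • 1))
      fun t _ => prod_mem_cardProducts _ (fun _ => 1) _ fun k _ =>
        Submodule.sub_mem _ (inducedCount_mem_cardProducts Y hYorder hYiso hY t)
          (Submodule.smul_mem _ _ (one_mem_cardProducts n 1))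
    simp only [Finset.sum_const, Finset.card_range, smul_eq_mul, mul_one] at h
    rwa [sum_cardCount hYiso hdel, horder] at h
  have hp_apply (ω) : p ω = ∏ t, ∏ k ∈ Finset.range (cardCount (Y t) (G j₀)),
      ((inducedCount n (Y t) ω.2 : ℝ) - k) := by
    simp [p, d, Finset.prod_apply]
  have hp_ne (j : J) (K : (G j).Sub) (h : p ⟨j, K⟩ ≠ 0) :
      (K = ⊤ ∧ (G j₀).Recon (G j)) ∨ deckSize (G j₀) < deckSize (G j) := by
    have hle (t : T) : cardCount (Y t) (G j₀) ≤ inducedCount n (Y t) K := by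
      by_contra! hlt
      refine h ?_
      rw [hp_apply]
      exact Finset.prod_eq_zero (Finset.mem_univ t)
        (Finset.prod_eq_zero (Finset.mem_range.2 hlt) (sub_self _))
    obtain ⟨f, hf, hfK, hfiso⟩ := exists_injective_of_cardCount_le hYiso hdel hle
    exact recon_or_deckSize_lt hn (horder j₀) (horder j) (hbig j) hf hfK hfiso
  have hp_top : p ⟨j₀, ⊤⟩ ≠ 0 := by
    rw [hp_apply]
    refine Finset.prod_ne_zero_iff.2 fun t _ => Finset.prod_ne_zero_iff.2 fun k hk => ?_
    have h1 := (Finset.mem_range.1 hk).trans_le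
      (cardCount_le_inducedCount_top (Y t) (horder j₀))
    exact sub_ne_zero.2 (Nat.cast_lt.2 h1).ne'
  have h := hkill p hp
  -- Only the term `(j₀, ⊤)` is left, with Möbius coefficient 1.
  rw [Finset.sum_eq_single j₀, Finset.sum_eq_single ⊤, hμtop, one_mul] at h
  · exact mul_ne_zero hj₀ hp_top h
  · intro K _ hK
    by_contra hz
    rcases hp_ne j₀ K (mul_ne_zero_iff.1 hz).2 with h | h
    · exact hK h.1
    · exact h.ne rfl
  · simp
  · intro j _ hj
    by_contra hz
    obtain ⟨haj, hz⟩ := mul_ne_zero_iff.1 hz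
    obtain ⟨K, -, hK⟩ := Finset.exists_ne_zero_of_sum_ne_zero hz
    rcases hp_ne j K (mul_ne_zero_iff.1 hK).2 with h | h
    · exact hj (hrecon _ _ h.2).symm
    · exact (hmax j (by simpa using haj)).not_gt h
  · simp

/-! ### Equivalent sequences and finite selections of rows -/

namespace SeqEquiv

theorem refl (F : List FinGraph) : SeqEquiv F F := ⟨Equiv.refl _, fun _ => Iso.refl _⟩

theorem symm {F F' : List FinGraph} : SeqEquiv F F' → SeqEquiv F' F := by
  rintro ⟨σ, h⟩
  refine ⟨σ.symm, fun i => ?_⟩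
  have h1 := (h (σ.symm i)).symm
  rwa [Equiv.apply_symm_apply] at h1

theorem trans {F F' F'' : List FinGraph} : SeqEquiv F F' → SeqEquiv F' F'' → SeqEquiv F F'' := by
  rintro ⟨σ, h⟩ ⟨σ', h'⟩
  exact ⟨σ.trans σ', fun i => (h i).trans (h' (σ i))⟩

theorem coverCount_eq {F F' : List FinGraph} (h : SeqEquiv F F') (G : FinGraph) :
    coverCount F G = coverCount F' G := by
  obtain ⟨σ, h⟩ := h
  refine Nat.card_congr ((σ.arrowCongr (Equiv.refl G.Sub)).subtypeEquiv fun S => ?_)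
  simp only [IsCover, Equiv.arrowCongr_apply, Equiv.coe_refl, comp_apply, id_eq]
  refine and_congr ?_ (and_congr ?_ ?_)
  · rw [← σ.forall_congr_right]
    simp only [Equiv.symm_apply_apply]
    exact forall_congr' fun i => ⟨fun hi => hi.trans (h i), fun hi => hi.trans (h i).symm⟩
  · rw [σ.symm.surjective.iUnion_comp fun i => (S i).verts]
  · rw [σ.symm.surjective.iUnion_comp fun i => (S i).edges]

end SeqEquiv

/-- Sequences of cards up to equivalence. -/
def cardSeqSetoid (n : ℕ) : Setoid {F : List FinGraph // IsCardSeq n F} where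
  r F F' := SeqEquiv F.1 F'.1
  iseqv := ⟨fun F => SeqEquiv.refl F.1, SeqEquiv.symm, SeqEquiv.trans⟩

theorem exists_isFullCardFamily (n : ℕ) :
    ∃ (ι : Type 1) (𝔉 : ι → List FinGraph), IsFullCardFamily n 𝔉 := by
  refine ⟨Quotient (cardSeqSetoid n), fun q => q.out.1, ⟨fun q => q.out.2, fun q q' hne h => ?_⟩,
    fun F hF => ⟨Quotient.mk (cardSeqSetoid n) ⟨F, hF⟩, ?_⟩⟩
  · exact hne (Quotient.out_equiv_out (s := cardSeqSetoid n).1 h)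
  · exact Quotient.exact (s := cardSeqSetoid n)
      (Quotient.out_eq (Quotient.mk (cardSeqSetoid n) ⟨F, hF⟩))

/-- Some finite set of rows has the full rank. -/
theorem exists_finite_rows_rank_eq {ι m : Type*} [Fintype m] (M : Matrix ι m ℝ) :
    ∃ (l : ℕ) (r : Fin l → ι), Injective r ∧ (M.submatrix r id).rank = M.rank := by
  obtain ⟨κ, a, ha, hspan, hind⟩ := exists_linearIndependent' ℝ M.row
  have : Finite κ := hind.finite
  let e := Finite.equivFin κ
  refine ⟨Nat.card κ, a ∘ e.symm, ha.comp e.symm.injective, ?_⟩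
  -- The chosen rows form a basis of the row space, so a vector annihilated by them is annihilated
  -- by all rows; rank-nullity on the finite set of columns then compares the ranks, even if `ι` is
  -- infinite.
  have hker : LinearMap.ker (M.submatrix (a ∘ e.symm) id).mulVecLin =
      LinearMap.ker M.mulVecLin := by
    ext x
    simp only [LinearMap.mem_ker, Matrix.mulVecLin_apply]
    constructor
    · intro h
      have hle : Submodule.span ℝ (Set.range M.row) ≤
          LinearMap.ker (LinearMap.applyₗ x ∘ₗ (dotProductBilin ℝ ℝ : _ →ₗ[ℝ] _ →ₗ[ℝ] ℝ)) := by
        rw [← hspan, Submodule.span_le]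
        rintro _ ⟨k, rfl⟩
        have hk := congrFun h (e k)
        simp only [Matrix.mulVec, Matrix.submatrix_apply, comp_apply, Equiv.symm_apply_apply] at hk
        exact hk
      ext i
      exact hle (Submodule.subset_span ⟨i, rfl⟩)
    · intro h
      ext i
      exact congrFun h _
  have h1 := (M.submatrix (a ∘ e.symm) id).mulVecLin.finrank_range_add_finrank_ker
  have h2 := M.mulVecLin.finrank_range_add_finrank_ker
  rw [hker] at h1
  rw [Matrix.rank, Matrix.rank]
  omega

/-! ### The two rank bounds -/

section Rank

variable {n : ℕ} {C : Set FinGraph}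

theorem IsoClass.rep_mem (q : IsoClass C) : q.rep ∈ C := (Quotient.out q).2

theorem IsoClass.eq_of_rep_iso {q q' : IsoClass C} (h : q.rep.Iso q'.rep) : q = q' :=
  Quotient.out_equiv_out (s := isoSetoid C).1 h

/-- The reconstruction class of an isomorphism class. -/
noncomputable def IsoClass.toRecon (q : IsoClass C) : ReconClass C :=
  Quotient.mk (reconSetoid C) (Quotient.out q)

theorem IsoClass.toRecon_eq_iff {q q' : IsoClass C} :
    q.toRecon = q'.toRecon ↔ q.rep.Recon q'.rep :=
  Quotient.eq (r := reconSetoid C)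

theorem IsoClass.toRecon_surjective : Surjective (toRecon : IsoClass C → ReconClass C) := by
  intro r
  refine ⟨Quotient.mk (isoSetoid C) (Quotient.out r), ?_⟩
  refine Eq.trans (Quotient.sound (s := reconSetoid C) ?_) (Quotient.out_eq r)
  exact (Quotient.mk_out (s := isoSetoid C) (Quotient.out r)).recon

/-- Multiplying by the invertible matrix `S` turns covering numbers into Kocay sums. These depend
only on the reconstruction class of the column, so the product factors through `ReconClass C`. -/
theorem rank_coverMatrix_le [Fintype (IsoClass C)] (hC : IsGraphClass n C)
    (hkocay : SatisfiesKocay n C) {ι : Type*} {𝔉 : ι → List FinGraph}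
    (h𝔉 : ∀ i, IsCardSeq n (𝔉 i)) :
    (coverMatrix 𝔉 C).rank ≤ Nat.card (ReconClass C) := by
  classical
  have : Finite (ReconClass C) := Finite.of_surjective _ IsoClass.toRecon_surjective
  let : Fintype (ReconClass C) := Fintype.ofFinite _
  let S : Matrix (IsoClass C) (IsoClass C) ℝ := Matrix.of fun q q' => (subCount q.rep q'.rep : ℝ)
  have hS : IsUnit S.det := (Matrix.isUnit_iff_isUnit_det _).1
    (isUnit_subCount_matrix IsoClass.rep n (fun q => (hC.1 _ q.rep_mem).1)
      fun _ _ => IsoClass.eq_of_rep_iso)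
  let σ : ReconClass C → IsoClass C := surjInv IsoClass.toRecon_surjective
  have hentry (i : ι) (q : IsoClass C) :
      (coverMatrix 𝔉 C * S) i q = (kocaySum C (𝔉 i) q.rep : ℝ) := by
    rw [kocaySum, finsum_eq_sum_of_fintype, Matrix.mul_apply]
    push_cast
    rfl
  let N : Matrix ι (ReconClass C) ℝ := Matrix.of fun i r => (coverMatrix 𝔉 C * S) i (σ r)
  let P : Matrix (ReconClass C) (IsoClass C) ℝ :=
    Matrix.of fun r q => if q.toRecon = r then (1 : ℝ) else 0
  have hfactor : coverMatrix 𝔉 C * S = N * P := by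
    ext i q
    refine Eq.trans ?_ (Matrix.mul_apply (M := N) (N := P)).symm
    rw [Finset.sum_eq_single q.toRecon]
    · have hP : P q.toRecon q = 1 := if_pos rfl
      have hN : N i q.toRecon = (kocaySum C (𝔉 i) (σ q.toRecon).rep : ℝ) := hentry i _
      rw [hP, hN, mul_one, hentry]
      refine congrArg _ (hkocay _ (IsoClass.rep_mem _) (𝔉 i) (fun X hX => ?_) _
        (hC.1 _ q.rep_mem).2 (IsoClass.toRecon_eq_iff.1 (surjInv_eq _ _)))
      have := (h𝔉 i).2 X hX
      omega
    · intro r _ hr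
      exact mul_eq_zero_of_right _ (if_neg hr.symm)
    · simp
  rw [← Matrix.rank_mul_eq_left_of_isUnit_det S _ hS, hfactor, Nat.card_eq_fintype_card]
  exact (Matrix.rank_mul_le_left _ _).trans (Matrix.rank_le_card_width _)

theorem le_rank_coverMatrix [Fintype (IsoClass C)] (hn : 2 ≤ n) (hC : IsGraphClass n C)
    {ι : Type*} {𝔉 : ι → List FinGraph} (h𝔉 : IsFullCardFamily n 𝔉) :
    Nat.card (ReconClass C) ≤ (coverMatrix 𝔉 C).rank := by
  classical
  have : Finite (ReconClass C) := Finite.of_surjective _ IsoClass.toRecon_surjective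
  let : Fintype (ReconClass C) := Fintype.ofFinite _
  let σ : ReconClass C → IsoClass C := surjInv IsoClass.toRecon_surjective
  have hσ (r) : (σ r).toRecon = r := surjInv_eq _ r
  -- The columns are taken inside the range, which is finite-dimensional even when `ι` is infinite.
  let v : ReconClass C → LinearMap.range (coverMatrix 𝔉 C).mulVecLin := fun r =>
    ⟨(coverMatrix 𝔉 C).mulVecLin (Pi.single (σ r) 1), LinearMap.mem_range_self _ _⟩
  have hv (r i) : (v r).1 i = (coverCount (𝔉 i) (σ r).rep : ℝ) := by
    simp [v, coverMatrix]
  have hind : LinearIndependent ℝ v := by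
    rw [Fintype.linearIndependent_iff]
    intro a ha
    refine congrFun (eq_zero_of_sum_coverCount_eq_zero hn (fun r => (σ r).rep)
      (fun r => (hC.1 _ (σ r).rep_mem).1) (fun r => (hC.1 _ (σ r).rep_mem).2)
      (fun r r' h => ?_) a fun F hF => ?_)
    · rw [← hσ r, ← hσ r', IsoClass.toRecon_eq_iff.2 h]
    · obtain ⟨i, hi⟩ := h𝔉.2 F hF
      have h := congrFun (congrArg Subtype.val ha) i
      rw [Submodule.coe_sum, Finset.sum_apply] at h
      refine Eq.trans (Finset.sum_congr rfl fun r _ => ?_) h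
      rw [Submodule.coe_smul, Pi.smul_apply, hv, smul_eq_mul, hi.coverCount_eq]
  rw [Nat.card_eq_fintype_card]
  exact hind.fintype_card_le_finrank

theorem rank_coverMatrix_eq [Fintype (IsoClass C)] (hn : 2 ≤ n) (hC : IsGraphClass n C)
    (hkocay : SatisfiesKocay n C) {ι : Type*} {𝔉 : ι → List FinGraph}
    (h𝔉 : IsFullCardFamily n 𝔉) : (coverMatrix 𝔉 C).rank = Nat.card (ReconClass C) :=
  le_antisymm (rank_coverMatrix_le hC hkocay h𝔉.1.1) (le_rank_coverMatrix hn hC h𝔉)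

end Rank

end GraphDecks

theorem theorem3 (n : ℕ) (hn : 2 ≤ n) (C : Set GraphDecks.FinGraph)
    (hC : GraphDecks.IsGraphClass n C) [Fintype (GraphDecks.IsoClass C)]
    (hrec : GraphDecks.Recognisable C) (hkocay : GraphDecks.SatisfiesKocay n C) :
    (∃ (l : ℕ) (𝔉 : Fin l → List GraphDecks.FinGraph), GraphDecks.IsInequivCardFamily n 𝔉 ∧
      (GraphDecks.coverMatrix 𝔉 C).rank = Nat.card (GraphDecks.ReconClass C)) ∧
    (∀ (ι : Type*) (𝔉 : ι → List GraphDecks.FinGraph), GraphDecks.IsFullCardFamily n 𝔉 →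
      (GraphDecks.coverMatrix 𝔉 C).rank = Nat.card (GraphDecks.ReconClass C)) := by
  refine ⟨?_, fun ι 𝔉 h𝔉 => GraphDecks.rank_coverMatrix_eq hn hC hkocay h𝔉⟩
  obtain ⟨ι, 𝔉, h𝔉⟩ := GraphDecks.exists_isFullCardFamily n
  obtain ⟨l, r, hr, hrank⟩ :=
    GraphDecks.exists_finite_rows_rank_eq (GraphDecks.coverMatrix 𝔉 C)
  exact ⟨l, 𝔉 ∘ r, ⟨fun i => h𝔉.1.1 (r i), fun i j hij => h𝔉.1.2 _ _ (hr.ne hij)⟩,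
    hrank.trans (GraphDecks.rank_coverMatrix_eq hn hC hkocay h𝔉)⟩
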